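/- Let $\Sigma=\{0,1\}$, and let $\mu$ be the Lebesgue (uniform product) measure on the space $\Sigma^{\mathbb N}$ of infinite binary sequences $X=X_1X_2X_3\ldots$. For a language $L\subseteq\Sigma^*$ let $[L]$ be the class of all sequences that have a prefix in $L$. An automatic family is a collection of languages $\mathcal U=(U_i)_{i\in I}$, $U_i\subseteq\Sigma^*$, such that $I\subseteq\Sigma^*$ is a regular language and the relation $\{(x,i)\mid i\in I,\ x\in U_i\}$ is automatic, i.e. the convolutions of its pairs (the two words are read in parallel, the shorter one being padded at its end with a special symbol $\#$) form a regular language over $\{0,1,\#\}^2$. Its covering region is $F(\mathcal U)=\bigcap_{i\in I}[U_i]$. The family $\mathcal U$ is an automatic randomness test (ART) if $I$ is infinite and $\liminf_{i\in I}\mu[U_i]=0$ (the lower limit is taken as $|i|\to\infty$), and it is a Martin-Löf automatic randomness test (MART) if $\mu[U_i]\le 2^{-|i|}$ for all $i\in I$. Two tests are equivalent if they have the same covering region. **Theorem.** ART and MART are not equivalent: there is an ART that is equivalent to no MART. More precisely, let $\mathcal C=\{X\in\Sigma^{\mathbb N}\mid X_{2i}=0\text{ for all } i\ge 1\}$. Then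 $\mathcal C=F(\mathcal U)$ for some ART $\mathcal U$, but $\mathcal C\ne F(\mathcal V)$ for every MART $\mathcal V$. -/

import Mathlib

open MeasureTheory Filter
open scoped ENNReal

namespace AutRand

/-- Finite words over the binary alphabet `{0, 1}`. -/
abbrev Word : Type := List (Fin 2)

/-- Infinite binary sequences. The sequence written `X₁ X₂ X₃ …` is the function with
`X k = X_{k+1}`, so the position numbered `n ≥ 1` is the argument `n - 1`. -/
abbrev Seq : Type := ℕ → Fin 2

/-- The convolution of two words: the word over `{0, 1, #} × {0, 1, #}` whose length is the
maximum of the two lengths and whose `k`-th letter is the pair of the `k`-th letters of `x` and `y`,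
a position beyond the end of a word being filled with the padding symbol `# = none`. -/
def convolution (x y : Word) : List (Option (Fin 2) × Option (Fin 2)) :=
  (List.range (max x.length y.length)).map fun k => (x[k]?, y[k]?)

/-- A binary relation on words is automatic if the language of the convolutions of its elements
is recognized by a finite automaton. -/
def IsAutomaticRelation (R : Set (Word × Word)) : Prop :=
  Language.IsRegular
    ({c | ∃ p ∈ R, c = convolution p.1 p.2} : Language (Option (Fin 2) × Option (Fin 2)))

/-- An automatic family `(U_i)_{i ∈ I}` of languages: the index set `I` is a regular language and
the relation `{(x, i) | i ∈ I, x ∈ U_i}` is automatic. -/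
structure AutomaticFamily where
  /-- The index set `I`. -/
  index : Language (Fin 2)
  /-- The language `U_i`, for `i ∈ I`. -/
  lang : {i : Word // i ∈ index} → Language (Fin 2)
  index_regular : index.IsRegular
  automatic : IsAutomaticRelation {p | ∃ h : p.2 ∈ index, p.1 ∈ lang ⟨p.2, h⟩}

/-- `w` is a finite prefix of the sequence `X`. -/
def IsPrefixOf (w : Word) (X : Seq) : Prop :=
  ∀ (k : ℕ) (h : k < w.length), X k = w[k]

/-- The class `[L]` of all sequences extending some word of `L`. -/
def openClass (L : Language (Fin 2)) : Set Seq :=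
  {X | ∃ w ∈ L, IsPrefixOf w X}

/-- Lebesgue measure on the Cantor space: the infinite product of the equiprobable measure
on `{0, 1}`. -/
noncomputable def cantorMeasure : Measure Seq :=
  Measure.infinitePi fun _ : ℕ => (PMF.uniformOfFintype (Fin 2)).toMeasure

namespace AutomaticFamily

/-- Martin-Löf automatic randomness test: `μ[U_i] ≤ 2^{-|i|}` for all `i ∈ I`. -/
def IsMART (U : AutomaticFamily) : Prop :=
  ∀ i, cantorMeasure (openClass (U.lang i)) ≤ (2⁻¹ : ℝ≥0∞) ^ i.1.length

/-- Automatic randomness test: `liminf_{i ∈ I} μ[U_i] = 0`. There are finitely many words of each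
length, so the cofinite filter on `I` says that `|i|` tends to infinity. If `I` is finite,
this lower limit is `⊤`, so that the index set of an automatic randomness test is infinite. -/
def IsART (U : AutomaticFamily) : Prop :=
  liminf (fun i => cantorMeasure (openClass (U.lang i))) cofinite = 0

/-- The covering region `F(U) = ⋂_{i ∈ I} [U_i]`. -/
def coveringRegion (U : AutomaticFamily) : Set Seq :=
  ⋂ i, openClass (U.lang i)

/-- Two tests are equivalent if they have the same covering region. -/
def Equivalent (U V : AutomaticFamily) : Prop :=
  U.coveringRegion = V.coveringRegion

end AutomaticFamily

/-- The class of all sequences `X₁ X₂ X₃ …` with `X_{2i} = 0` for all `i ≥ 1`. -/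
def evenZero : Set Seq :=
  {X | ∀ k : ℕ, X (2 * k + 1) = 0}

end AutRand

/-! For the ART, let `U_i` consist of the words of length `|i|` that vanish at odd indices; its
measure tends to `0`. Now let `V` be a MART covering `evenZero`. A word of `V_i` has length at least
`|i|` (`IsMART.length_le`). Past that length the automaton reads only padding beside it, so
finiteness of the state set gives an `m`, independent of `i`, such that a prefix of length `|i|`
extendable into `V_i` is extendable by at most `m` letters (`exists_bound_extension`). If `|i| ≥
2(m+1)`, the `m+1` first free letters of `evenZero` give `2^(m+1)` disjoint cylinders in `[V_i]`,
each of measure at least `2^(-|i|-m)`: twice the allowed total. So `V` has finitely many indices and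
its covering region is open, whereas `evenZero` is not. -/

namespace AutRand

/-! ### Cylinders and their measure -/

section Measure

instance : IsProbabilityMeasure cantorMeasure := by
  unfold cantorMeasure; infer_instance

theorem cantorMeasure_eqOn (s : Finset ℕ) (a : Seq) :
    cantorMeasure {X | ∀ k ∈ s, X k = a k} = (2⁻¹ : ℝ≥0∞) ^ s.card := by
  have h : {X : Seq | ∀ k ∈ s, X k = a k} = Set.pi (s : Set ℕ) fun k => {a k} := by
    ext X; simp [Set.mem_pi]
  rw [h, cantorMeasure, Measure.infinitePi_pi _ fun _ _ => measurableSet_singleton _]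
  simp

theorem setOf_isPrefixOf (w : Word) :
    {X | IsPrefixOf w X} = {X : Seq | ∀ k ∈ Finset.range w.length, X k = w.getD k 0} := by
  ext X
  simp only [IsPrefixOf, Set.mem_ofPred_eq, Finset.mem_range]
  refine forall₂_congr fun k h => ?_
  rw [List.getD_eq_getElem _ _ h]

theorem cantorMeasure_isPrefixOf (w : Word) :
    cantorMeasure {X | IsPrefixOf w X} = (2⁻¹ : ℝ≥0∞) ^ w.length := by
  rw [setOf_isPrefixOf, cantorMeasure_eqOn, Finset.card_range]

theorem measurableSet_isPrefixOf (w : Word) : MeasurableSet {X | IsPrefixOf w X} := by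
  rw [setOf_isPrefixOf]
  simp only [Set.ofPred_forall]
  exact .iInter fun k => .iInter fun _ => measurable_pi_apply k (measurableSet_singleton _)

theorem isOpen_isPrefixOf (w : Word) : IsOpen {X | IsPrefixOf w X} := by
  rw [setOf_isPrefixOf]
  simp only [Set.ofPred_forall]
  refine isOpen_biInter_finset fun k _ => ?_
  have hk : Continuous fun X : Seq => X k := continuous_apply k
  exact (isOpen_discrete {w.getD k 0}).preimage hk

theorem isOpen_openClass (L : Language (Fin 2)) : IsOpen (openClass L) := by
  have : openClass L = ⋃ w ∈ L, {X | IsPrefixOf w X} := by ext X; simp [openClass]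
  rw [this]
  exact isOpen_biUnion fun w _ => isOpen_isPrefixOf w

theorem two_inv_pow_le_iff {m n : ℕ} : (2⁻¹ : ℝ≥0∞) ^ m ≤ 2⁻¹ ^ n ↔ n ≤ m := by
  rw [← ENNReal.inv_pow, ← ENNReal.inv_pow, ENNReal.inv_le_inv]
  exact_mod_cast Nat.pow_le_pow_iff_right (a := 2) (by norm_num)

end Measure

/-! ### Convolution of words -/

section Convolution

theorem length_convolution (x y : Word) :
    (convolution x y).length = max x.length y.length := by
  simp [convolution]

theorem convolution_cons_cons (a b : Fin 2) (x y : Word) :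
    convolution (a :: x) (b :: y) = (some a, some b) :: convolution x y := by
  simp only [convolution, List.length_cons, Nat.add_max_add_right, List.range_succ_eq_map,
    List.map_cons, List.map_map]
  rfl

theorem convolution_nil_right (x : Word) :
    convolution x [] = x.map fun a => (some a, none) := by
  apply List.ext_getElem <;> simp +contextual [convolution]

theorem convolution_append_left {u y : Word} (h : u.length = y.length) (v : Word) :
    convolution (u ++ v) y = convolution u y ++ v.map fun a => (some a, none) := by
  induction u generalizing y with
  | nil =>
    obtain rfl : y = [] := List.length_eq_zero_iff.mp h.symm
    simp [convolution_nil_right]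
  | cons a u ih =>
    cases y with
    | nil => simp at h
    | cons b y =>
      simp only [List.cons_append, convolution_cons_cons, ih (by simpa using h)]

theorem getElem?_convolution {x y : Word} {k : ℕ} (h : k < max x.length y.length) :
    (convolution x y)[k]? = some (x[k]?, y[k]?) := by
  simp only [convolution, List.getElem?_map, List.getElem?_range h, Option.map_some]

/-- The padding symbol is no letter, so each component determines its word, length included. -/
theorem convolution_injective {x y x' y' : Word} (h : convolution x y = convolution x' y') :
    x = x' ∧ y = y' := by
  have hl : max x.length y.length = max x'.length y'.length := by
    rw [← length_convolution, h, length_convolution]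
  have key : ∀ k : ℕ, x[k]? = x'[k]? ∧ y[k]? = y'[k]? := by
    intro k
    by_cases hk : k < max x.length y.length
    · have h1 := getElem?_convolution hk
      rw [h, getElem?_convolution (hl ▸ hk)] at h1
      simp only [Option.some.injEq, Prod.mk.injEq] at h1
      exact ⟨h1.1.symm, h1.2.symm⟩
    · have hk' := hk
      rw [hl] at hk'
      simp only [lt_max_iff, not_or, not_lt] at hk hk'
      simp [hk, hk']
  exact ⟨List.ext_getElem? fun k => (key k).1, List.ext_getElem? fun k => (key k).2⟩

end Convolution

/-! ### An ART covering exactly `evenZero` -/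

section EvenZeroTest

/-- The letters of `x` at the even indices (if `b`) or at the odd indices (if not `b`) are `0`. -/
def AlternatelyZero (b : Bool) (x : Word) : Prop :=
  ∀ (k : ℕ) (h : k < x.length), (Even k ↔ b) → x[k] = 0

theorem alternatelyZero_cons (b : Bool) (a : Fin 2) (x : Word) :
    AlternatelyZero b (a :: x) ↔ (b → a = 0) ∧ AlternatelyZero (!b) x := by
  constructor
  · refine fun h => ⟨fun hb => h 0 (by simp) (by simp [hb]), fun k hk hkb => ?_⟩
    refine h (k + 1) (by simpa using hk) ?_
    rw [Nat.even_add_one, hkb]; simp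
  · rintro ⟨h0, h⟩ (_ | k) hk hkb
    · exact h0 (by simpa using hkb)
    · refine h k (by simpa using hk) ?_
      rw [Nat.even_add_one] at hkb
      rw [← not_iff_not, hkb]; simp

/-- The automaton for pairs of words of equal length, the first of which has only zeros at the
odd indices. A state `some b` says that the next letter of the first word has to be `0` if `b`;
the state `none` rejects. -/
def evenZeroDFA : DFA (Option (Fin 2) × Option (Fin 2)) (Option Bool) where
  step
    | some b, (some a, some _) => if b ∧ a ≠ 0 then none else some !b
    | _, _ => none
  start := some false
  accept := {s | s.isSome}

theorem evenZeroDFA_evalFrom_none (c : List (Option (Fin 2) × Option (Fin 2))) :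
    evenZeroDFA.evalFrom none c = none := by
  induction c with
  | nil => rfl
  | cons p c ih => exact ih

/-- The flag `b` is arbitrary because each letter flips it in the induction. -/
theorem evenZeroDFA_evalFrom_some (b : Bool) (c : List (Option (Fin 2) × Option (Fin 2))) :
    evenZeroDFA.evalFrom (some b) c ∈ evenZeroDFA.accept ↔
      ∃ x y : Word, x.length = y.length ∧ AlternatelyZero b x ∧ c = convolution x y := by
  induction c generalizing b with
  | nil =>
    refine iff_of_true rfl ⟨[], [], rfl, fun k h => by simp at h, rfl⟩
  | cons p c ih =>
    rw [DFA.evalFrom_cons]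
    constructor
    · intro h
      rcases p with ⟨_ | a, _ | d⟩
      iterate 3
        have : evenZeroDFA.evalFrom none c ∈ evenZeroDFA.accept := h
        rw [evenZeroDFA_evalFrom_none] at this
        cases this
      by_cases hb : b ∧ a ≠ 0
      · have hs : evenZeroDFA.step (some b) (some a, some d) = none := if_pos hb
        rw [hs, evenZeroDFA_evalFrom_none] at h
        cases h
      · have hs : evenZeroDFA.step (some b) (some a, some d) = some !b := if_neg hb
        rw [hs, ih] at h
        obtain ⟨x, y, hl, hx, rfl⟩ := h
        refine ⟨a :: x, d :: y, by simp [hl], ?_, (convolution_cons_cons ..).symm⟩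
        rw [alternatelyZero_cons]
        exact ⟨fun h => not_not.mp fun ha => hb ⟨h, ha⟩, hx⟩
    · rintro ⟨_ | ⟨a, x⟩, _ | ⟨d, y⟩, hl, hx, hc⟩
      · simp [convolution] at hc
      · simp at hl
      · simp at hl
      · rw [convolution_cons_cons, List.cons.injEq] at hc
        obtain ⟨rfl, hc⟩ := hc
        rw [alternatelyZero_cons] at hx
        have hs : evenZeroDFA.step (some b) (some a, some d) = some !b :=
          if_neg fun h => h.2 (hx.1 h.1)
        rw [hs, ih]
        exact ⟨x, y, by simpa using hl, hx.2, hc⟩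

/-- The family of all `U_i = {x | |x| = |i| and x has only zeros at the odd indices}`. -/
def evenZeroFamily : AutomaticFamily where
  index := ⊤
  lang i := {x | x.length = i.1.length ∧ AlternatelyZero false x}
  index_regular := Language.isRegular_iff.mpr
    ⟨Unit, inferInstance, ⟨fun _ _ => (), (), Set.univ⟩, by ext; simp [DFA.mem_accepts]; trivial⟩
  automatic := by
    refine Language.isRegular_iff.mpr ⟨Option Bool, inferInstance, evenZeroDFA, ?_⟩
    ext c
    refine (evenZeroDFA_evalFrom_some false c).trans ?_
    constructor
    · rintro ⟨x, y, hl, hx, rfl⟩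
      exact ⟨(x, y), ⟨trivial, hl, hx⟩, rfl⟩
    · rintro ⟨⟨x, y⟩, ⟨_, hl, hx⟩, rfl⟩
      exact ⟨x, y, hl, hx, rfl⟩

theorem openClass_evenZeroFamily (i : {i // i ∈ evenZeroFamily.index}) :
    openClass (evenZeroFamily.lang i) = {X | ∀ k, 2 * k + 1 < i.1.length → X (2 * k + 1) = 0} := by
  ext X
  constructor
  · rintro ⟨w, ⟨hl, hw⟩, hX⟩ k hk
    rw [← hl] at hk
    rw [hX _ hk]
    exact hw _ hk (by simp)
  · intro h
    refine ⟨List.ofFn fun k : Fin i.1.length => X k, ⟨by simp, fun k hk hkb => ?_⟩,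
      fun k hk => by simp⟩
    obtain ⟨j, rfl⟩ : Odd k := by simpa using hkb
    simpa using h j (by simpa using hk)

theorem coveringRegion_evenZeroFamily : evenZeroFamily.coveringRegion = evenZero := by
  ext X
  simp only [AutomaticFamily.coveringRegion, openClass_evenZeroFamily, Set.mem_iInter]
  constructor
  -- Any index longer than `2k+1` controls the letter there.
  · exact fun h k => h ⟨List.replicate (2 * k + 2) 0, trivial⟩ k (by simp)
  · exact fun h i k _ => h k

theorem cantorMeasure_evenZeroFamily_le (i : {i // i ∈ evenZeroFamily.index}) :
    cantorMeasure (openClass (evenZeroFamily.lang i)) ≤ 2⁻¹ ^ (i.1.length / 2) := by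
  have hinj : Function.Injective fun k : ℕ => 2 * k + 1 := fun a b h => by
    simpa using h
  have h := cantorMeasure_eqOn ((Finset.range (i.1.length / 2)).map ⟨_, hinj⟩) 0
  rw [Finset.card_map, Finset.card_range] at h
  rw [← h, openClass_evenZeroFamily]
  refine measure_mono fun X hX k hk => ?_
  simp only [Finset.mem_map, Finset.mem_range, Function.Embedding.coeFn_mk] at hk
  obtain ⟨j, hj, rfl⟩ := hk
  exact hX j (by omega)

theorem isART_evenZeroFamily : evenZeroFamily.IsART := by
  have hlen : Tendsto (fun i : {i // i ∈ evenZeroFamily.index} => i.1.length / 2)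
      cofinite atTop := by
    refine tendsto_atTop.mpr fun n => ?_
    rw [eventually_cofinite]
    refine ((List.finite_length_lt (Fin 2) (2 * n)).preimage
      Subtype.val_injective.injOn).subset fun i hi => ?_
    simp only [Set.mem_ofPred_eq, Set.mem_preimage] at hi ⊢
    omega
  have hpow : Tendsto (fun n : ℕ => (2⁻¹ : ℝ≥0∞) ^ n) atTop (nhds 0) :=
    ENNReal.tendsto_pow_atTop_nhds_zero_of_lt_one (by simp)
  -- A limit equals the lower limit only along a nontrivial filter, hence the need for infinitely
  -- many indices.
  have : (cofinite : Filter {i // i ∈ evenZeroFamily.index}).NeBot := by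
    have := Infinite.of_injective (fun n => (⟨List.replicate n 0, trivial⟩ : {i // i ∈ evenZeroFamily.index})) fun m n h => by
      simpa using congrArg (fun i : {i // i ∈ evenZeroFamily.index} => i.1.length) h
    infer_instance
  exact (tendsto_of_tendsto_of_tendsto_of_le_of_le tendsto_const_nhds (hpow.comp hlen)
    (fun _ => zero_le) cantorMeasure_evenZeroFamily_le).liminf_eq

end EvenZeroTest

/-! ### No MART covers exactly `evenZero` -/

section MartinLof

/-- The zero sequence is a limit of sequences with a single `1`, at an odd index. -/
theorem not_isOpen_evenZero : ¬ IsOpen evenZero := by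
  intro h
  have ht : Tendsto (fun n : ℕ => (Pi.single (2 * n + 1) 1 : Seq)) atTop (nhds 0) := by
    refine tendsto_pi_nhds.mpr fun k => tendsto_const_nhds.congr' ?_
    filter_upwards [eventually_gt_atTop k] with n hn
    rw [Pi.single_eq_of_ne (by omega)]; rfl
  obtain ⟨n, hn⟩ := (ht.eventually (h.mem_nhds fun _ => rfl)).exists
  simpa using hn n

/-- Fix one witness for each state that has one, and take the maximal length. -/
theorem DFA.exists_bound_of_map {α β σ : Type*} [Finite σ] (M : DFA α σ) (f : β → α) :
    ∃ m : ℕ, ∀ q, (∃ v : List β, M.evalFrom q (v.map f) ∈ M.accept) →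
      ∃ v : List β, v.length ≤ m ∧ M.evalFrom q (v.map f) ∈ M.accept := by
  classical
  have := Fintype.ofFinite σ
  have h : ∀ q, ∃ m : ℕ, (∃ v : List β, M.evalFrom q (v.map f) ∈ M.accept) →
      ∃ v : List β, v.length ≤ m ∧ M.evalFrom q (v.map f) ∈ M.accept := fun q => by
    by_cases hq : ∃ v : List β, M.evalFrom q (v.map f) ∈ M.accept
    · exact hq.elim fun v hv => ⟨v.length, fun _ => ⟨v, le_rfl, hv⟩⟩
    · exact ⟨0, fun h => absurd h hq⟩
  choose b hb using h
  refine ⟨Finset.univ.sup b, fun q hq => ?_⟩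
  obtain ⟨v, hl, hv⟩ := hb q hq
  exact ⟨v, hl.trans (Finset.le_sup (Finset.mem_univ q)), hv⟩

/-- There is a bound, uniform in `i`, on the length of a shortest extension within `U_i` of a word
of length `|i|`. -/
theorem AutomaticFamily.exists_bound_extension (U : AutomaticFamily) :
    ∃ m : ℕ, ∀ (i : {i // i ∈ U.index}) (u : Word), u.length = i.1.length →
      (∃ v, u ++ v ∈ U.lang i) → ∃ v : Word, v.length ≤ m ∧ u ++ v ∈ U.lang i := by
  obtain ⟨σ, _, M, hM⟩ := U.automatic
  obtain ⟨m, hm⟩ := DFA.exists_bound_of_map M fun a : Fin 2 => (some a, (none : Option (Fin 2)))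
  -- Membership of `u ++ v` depends on `u` and `i` only through the state reached after their
  -- convolution.
  have key : ∀ (i : {i // i ∈ U.index}) (u v : Word), u.length = i.1.length →
      (u ++ v ∈ U.lang i ↔
        M.evalFrom (M.eval (convolution u i)) (v.map fun a => (some a, none)) ∈ M.accept) := by
    intro i u v hu
    rw [DFA.eval, ← DFA.evalFrom_of_append, ← convolution_append_left hu]
    change _ ↔ convolution (u ++ v) i ∈ M.accepts
    rw [hM]
    constructor
    · exact fun h => ⟨(u ++ v, i), ⟨i.2, h⟩, rfl⟩
    · rintro ⟨⟨x, j⟩, ⟨hj, hx⟩, hc⟩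
      obtain ⟨rfl, rfl⟩ := convolution_injective hc
      exact hx
  refine ⟨m, fun i u hu ⟨v, hv⟩ => ?_⟩
  obtain ⟨v', hl, hv'⟩ := hm _ ⟨v, (key i u v hu).mp hv⟩
  exact ⟨v', hl, (key i u v' hu).mpr hv'⟩

/-- The cylinder of `w` lies in `[V_i]`, so `2^(-|w|) ≤ 2^(-|i|)`. -/
theorem AutomaticFamily.IsMART.length_le {V : AutomaticFamily} (hV : V.IsMART)
    {i : {i // i ∈ V.index}} {w : Word} (hw : w ∈ V.lang i) : i.1.length ≤ w.length := by
  rw [← two_inv_pow_le_iff, ← cantorMeasure_isPrefixOf]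
  refine (measure_mono ?_).trans (hV i)
  exact fun X hX => ⟨w, hw, hX⟩

/-- The sequence in `evenZero` whose first letters at the even indices are given by `f`. -/
def evenZeroSeq {n : ℕ} (f : Fin n → Fin 2) : Seq := fun j =>
  if h : Even j ∧ j / 2 < n then f ⟨j / 2, h.2⟩ else 0

theorem evenZeroSeq_mem {n : ℕ} (f : Fin n → Fin 2) : evenZeroSeq f ∈ evenZero := fun k =>
  dif_neg (by simp)

theorem evenZeroSeq_two_mul {n : ℕ} (f : Fin n → Fin 2) (k : Fin n) :
    evenZeroSeq f (2 * k) = f k := by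
  simp [evenZeroSeq]

theorem AutomaticFamily.IsMART.finite_index {V : AutomaticFamily} (hV : V.IsMART)
    (h : evenZero ⊆ V.coveringRegion) : Finite {i // i ∈ V.index} := by
  obtain ⟨m, hm⟩ := V.exists_bound_extension
  suffices hlen : ∀ i : {i // i ∈ V.index}, i.1.length < 2 * (m + 1) from
    ((List.finite_length_lt (Fin 2) (2 * (m + 1))).subset fun i hi => hlen ⟨i, hi⟩).to_subtype
  intro i
  by_contra! hi
  have hex : ∀ f : Fin (m + 1) → Fin 2, ∃ w ∈ V.lang i, w.length ≤ i.1.length + m ∧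
      ∀ (k : ℕ) (hk : k < w.length), k < i.1.length → w[k] = evenZeroSeq f k := by
    intro f
    obtain ⟨w, hw, hp⟩ := Set.mem_iInter.mp (h (evenZeroSeq_mem f)) i
    have hu : (w.take i.1.length).length = i.1.length := by simp [hV.length_le hw]
    -- Replace the tail of `w` by a short one, keeping its first `|i|` letters.
    obtain ⟨v, hv, hmem⟩ := hm i _ hu ⟨w.drop i.1.length, by rwa [List.take_append_drop]⟩
    refine ⟨_, hmem, by rw [List.length_append, hu]; omega, fun k _ hk => ?_⟩
    rw [List.getElem_append_left (hk.trans_eq hu.symm), List.getElem_take,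
      hp k (hk.trans_le (hV.length_le hw))]
  choose w hw hl hk using hex
  have hdisj : Pairwise (Function.onFun Disjoint fun f => {X | IsPrefixOf (w f) X}) := by
    intro f g hfg
    refine Set.disjoint_left.mpr fun X hf hg => hfg (funext fun k => ?_)
    -- The bound `2(m+1)` puts all coded letters within the first `|i|`, where the new words still
    -- follow `evenZeroSeq`.
    have hki : 2 * (k : ℕ) < i.1.length := by omega
    have hf' := hki.trans_le (hV.length_le (hw f))
    have hg' := hki.trans_le (hV.length_le (hw g))
    rw [← evenZeroSeq_two_mul f, ← evenZeroSeq_two_mul g, ← hk f _ hf' hki, ← hk g _ hg' hki,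
      ← hf _ hf', ← hg _ hg']
  have hsum : ∑ f, cantorMeasure {X | IsPrefixOf (w f) X} ≤ 2⁻¹ ^ i.1.length := by
    rw [← tsum_fintype (L := .unconditional _), ← measure_iUnion hdisj fun f => measurableSet_isPrefixOf _]
    refine (measure_mono ?_).trans (hV i)
    exact Set.iUnion_subset fun f X hX => ⟨w f, hw f, hX⟩
  have hlow : ∑ _f : Fin (m + 1) → Fin 2, (2⁻¹ : ℝ≥0∞) ^ (i.1.length + m) ≤ 2⁻¹ ^ i.1.length := by
    refine (Finset.sum_le_sum fun f _ => ?_).trans hsum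
    rw [cantorMeasure_isPrefixOf, two_inv_pow_le_iff]
    exact hl f
  have hmul : (2 : ℝ≥0∞) ^ m * 2⁻¹ ^ m = 1 := by
    rw [← mul_pow, ENNReal.mul_inv_cancel (by simp) (by simp), one_pow]
  have hcalc : ∑ _f : Fin (m + 1) → Fin 2, (2⁻¹ : ℝ≥0∞) ^ (i.1.length + m) =
      2 * 2⁻¹ ^ i.1.length := by
    simp only [Finset.sum_const, Finset.card_univ, Fintype.card_pi, Fintype.card_fin,
      Finset.prod_const, nsmul_eq_mul, Nat.cast_pow, Nat.cast_ofNat]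
    calc (2 : ℝ≥0∞) ^ (m + 1) * 2⁻¹ ^ (i.1.length + m)
        = 2 * 2⁻¹ ^ i.1.length * (2 ^ m * 2⁻¹ ^ m) := by ring
      _ = _ := by rw [hmul, mul_one]
  rw [hcalc] at hlow
  have hpos : (2⁻¹ : ℝ≥0∞) ^ i.1.length ≠ 0 := by simp
  have hfin : (2⁻¹ : ℝ≥0∞) ^ i.1.length ≠ ⊤ := by finiteness
  rw [two_mul] at hlow
  exact absurd hlow (ENNReal.lt_add_right hfin hpos).not_ge

theorem AutomaticFamily.IsMART.coveringRegion_ne {V : AutomaticFamily} (hV : V.IsMART) :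
    V.coveringRegion ≠ evenZero := by
  intro h
  have := hV.finite_index h.ge
  exact not_isOpen_evenZero (h ▸ isOpen_iInter_of_finite fun i => isOpen_openClass _)

end MartinLof

end AutRand

theorem theorem10 :
    (∃ U : AutRand.AutomaticFamily, U.IsART ∧ U.coveringRegion = AutRand.evenZero) ∧
    (∀ V : AutRand.AutomaticFamily, V.IsMART → V.coveringRegion ≠ AutRand.evenZero) ∧
    ¬ (∀ U : AutRand.AutomaticFamily, U.IsART →
        ∃ V : AutRand.AutomaticFamily, V.IsMART ∧ U.Equivalent V) := by
  refine ⟨⟨_, AutRand.isART_evenZeroFamily, AutRand.coveringRegion_evenZeroFamily⟩,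
    fun V hV => hV.coveringRegion_ne, fun h => ?_⟩
  obtain ⟨V, hV, he⟩ := h _ AutRand.isART_evenZeroFamily
  exact hV.coveringRegion_ne (he.symm.trans AutRand.coveringRegion_evenZeroFamily)
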